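/- Let $C$ be an algebraically closed field of characteristic zero (for instance $C=\mathbb C$) and $K=C(x,y)$, with partial derivatives $f_x,f_y$. A differential extension field of $K$ is a field extension with commuting derivations that extend $\partial/\partial x$ and $\partial/\partial y$; $df=f_x\,dx+f_y\,dy$ denotes the corresponding differential, and $f$ is constant if $df=0$. A differential extension field $L$ of $K$ is elementary if it has the same constants as $K$ and there is a tower $K=K_0\subseteq K_1\subseteq\dots\subseteq K_s=L$ such that, for each $i$, either $K_{i+1}=K_i(t)$ with $t\neq 0$ and $dt/t=dR$ for some $R\in K_i$, or $K_{i+1}=K_i(t)$ with $dt=dR/R$ for some nonzero $R\in K_i$, or $K_{i+1}$ is a finite algebraic extension of $K_i$. Let $\mathcal X=X_1\,\partial/\partial x+X_2\,\partial/\partial y$ with $X_1,X_2\in K$ be a rational vector field. A first integral of $\mathcal X$ in a differential extension field is a non-constant element $\phi$ with $X_1\phi_x+X_2\phi_y=0$; it is called elementary if it lies in an elementary extension of $K$, and rational if it lies in $K$. Say that $\mathcal X$ has a logarithmic relation over $L$ if there are $m\ge 0$, $c_1,\dots,c_m\in C$, $u_1,\dots,u_m\in L\setminus\{0\}$ and $v\in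 L$ such that the one-form $$\beta=\sum_{i=1}^m c_i\,\frac{du_i}{u_i}+dv=\beta_1\,dx+\beta_2\,dy$$ is nonzero and satisfies $X_1\beta_1+X_2\beta_2=0$. Call $\mathcal X$ exceptional if it has an elementary first integral but no logarithmic relation over $K$. For $k,h,g_1,\dots,g_m\in K$ with $k$ not a square in $K$, and $c_1,\dots,c_m\in C$, put $$H=\begin{pmatrix}-\bigl(h_y+\tfrac12 h\tfrac{k_y}{k}\bigr)\\[2pt] h_x+\tfrac12 h\tfrac{k_x}{k}\end{pmatrix}+\sum_{i=1}^m\frac{c_i}{(g_i^2-k)^2}\begin{pmatrix}-2\bigl(-g_i^2g_{i,y}+kg_{i,y}-g_ik_y\bigr)-g_i(g_i^2+k)\tfrac{k_y}{k}\\[2pt] 2\bigl(-g_i^2g_{i,x}+kg_{i,x}-g_ik_x\bigr)+g_i(g_i^2+k)\tfrac{k_x}{k}\end{pmatrix}.$$ (a) Let $\mathcal X$ be exceptional, and suppose that it has a logarithmic relation over a field extension $L$ of $K$ of degree $2$ (with the derivations extended from $K$). Then $L=K(\sqrt k)$ for some non-square $k\in K$, and for every such $k$ there are $h,g_1,\dots,g_m\in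 K$ and $c_1,\dots,c_m\in C$, linearly independent over $\mathbb Q$, such that $\mathcal X=r\,H$ for some $r\in K$. (b) Let $k,h,g_1,\dots,g_m\in K$ with $k$ not a square in $K$, and let $c_1,\dots,c_m\in C$ be arbitrary. Then $H$ is exceptional if and only if it admits no rational first integral. -/

import Mathlib

universe u

noncomputable section

namespace PlaneVF

/-- The rational function field `K = C(x, y)`; `x` is the variable `0` and `y` the variable `1`. -/
abbrev RatXY (C : Type*) [Field C] := FractionRing (MvPolynomial (Fin 2) C)

section Partial

variable (C : Type*) [Field C]

/-- The partial derivative of polynomials in the `j`-th variable, with values in `C(x, y)`. -/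
def polyPartial (j : Fin 2) : Derivation C (MvPolynomial (Fin 2) C) (RatXY C) :=
  (Algebra.linearMap (MvPolynomial (Fin 2) C) (RatXY C)).compDer (MvPolynomial.pderiv j)

/-- The partial derivative `∂ / ∂x` (for `j = 0`) or `∂ / ∂y` (for `j = 1`) on `C(x, y)`:
the unique derivation of `C(x, y)` that extends the partial derivative of polynomials (it is
obtained from `Ω[C(x,y) / C] = C(x,y) ⊗ Ω[C[x,y] / C]`). -/
def partialDeriv (j : Fin 2) : Derivation C (RatXY C) (RatXY C) :=
  have : Algebra.FormallyEtale (MvPolynomial (Fin 2) C) (RatXY C) :=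
    Algebra.FormallyEtale.of_isLocalization (nonZeroDivisors (MvPolynomial (Fin 2) C))
  ((polyPartial C j).liftKaehlerDifferential.liftBaseChange (RatXY C) ∘ₗ
    (KaehlerDifferential.tensorKaehlerEquivOfFormallyEtale C
      (MvPolynomial (Fin 2) C) (RatXY C)).symm.toLinearMap).compDer
    (KaehlerDifferential.D C (RatXY C))

/-- On polynomials, `partialDeriv` is the usual partial derivative. -/
theorem partialDeriv_algebraMap (j : Fin 2) (p : MvPolynomial (Fin 2) C) :
    partialDeriv C j (algebraMap _ (RatXY C) p) =
      algebraMap _ (RatXY C) (MvPolynomial.pderiv j p) := by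
  have : Algebra.FormallyEtale (MvPolynomial (Fin 2) C) (RatXY C) :=
    Algebra.FormallyEtale.of_isLocalization (nonZeroDivisors (MvPolynomial (Fin 2) C))
  simp [partialDeriv, polyPartial,
    KaehlerDifferential.tensorKaehlerEquivOfFormallyEtale_symm_D_algebraMap]

end Partial

section Extension

variable {C : Type*} [Field C]
variable {L : Type*} [Field L] [Algebra C L]

/-- `f` is a constant: `df = 0`. -/
def IsConstant (D : Fin 2 → Derivation C L L) (f : L) : Prop :=
  ∀ j, D j f = 0

/-- The components `β₀, β₁` of the one-form
`∑ i, c i * d(u i) / u i + dv = β₀ dx + β₁ dy` over `L`. -/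
def logForm (D : Fin 2 → Derivation C L L) {m : ℕ} (c : Fin m → C) (u : Fin m → L) (v : L) :
    Fin 2 → L :=
  fun j => ∑ i, c i • (D j (u i) / u i) + D j v

variable [Algebra (RatXY C) L]

/-- The field extension `L` of `K = C(x, y)`, with the derivations `D 0, D 1`, is a differential
extension field of `(K, ∂/∂x, ∂/∂y)`: the derivations extend the partial derivatives, and they
commute. -/
def IsDifferentialExtension (D : Fin 2 → Derivation C L L) : Prop :=
  (∀ j f, D j (algebraMap (RatXY C) L f) = algebraMap (RatXY C) L (partialDeriv C j f)) ∧
    ∀ f, D 0 (D 1 f) = D 1 (D 0 f)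

/-- The derivative `X₀ ∂f/∂x + X₁ ∂f/∂y` of `f ∈ L` along the rational vector field
`X = X₀ ∂/∂x + X₁ ∂/∂y`. -/
def lieDeriv (D : Fin 2 → Derivation C L L) (X : Fin 2 → RatXY C) (f : L) : L :=
  ∑ j, algebraMap (RatXY C) L (X j) * D j f

/-- `f ∈ L` is a first integral of `X`: it is not constant, and its derivative along `X`
vanishes. -/
def IsFirstIntegral (D : Fin 2 → Derivation C L L) (X : Fin 2 → RatXY C) (f : L) : Prop :=
  ¬ IsConstant D f ∧ lieDeriv D X f = 0

/-- There are `v ∈ L`, `u₁, …, uₘ ∈ L \ {0}` and `c₁, …, cₘ ∈ C` such that the one-form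
`β = ∑ i, c i * d(u i) / u i + dv` is not zero and annihilates `X = X₀ ∂/∂x + X₁ ∂/∂y`.
For `X = -Q ∂/∂x + P ∂/∂y` and `ω = P dx + Q dy` the latter says `β ∧ ω = 0`. -/
def HasLogRelation (D : Fin 2 → Derivation C L L) (X : Fin 2 → RatXY C) : Prop :=
  ∃ (m : ℕ) (c : Fin m → C) (u : Fin m → L) (v : L),
    (∀ i, u i ≠ 0) ∧ logForm D c u v ≠ 0 ∧
      ∑ j, algebraMap (RatXY C) L (X j) * logForm D c u v j = 0

/-- `IsElementaryTower D F`: there is a tower `K = K₀ ⊆ K₁ ⊆ … ⊆ Kₘ = F` in which every step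
adjoins an exponential, adjoins a logarithm, or is a finite algebraic extension. -/
inductive IsElementaryTower (D : Fin 2 → Derivation C L L) :
    IntermediateField (RatXY C) L → Prop
  | base : IsElementaryTower D ⊥
  | exponential (F : IntermediateField (RatXY C) L) (t R : L) (hF : IsElementaryTower D F)
      (hR : R ∈ F) (ht : t ≠ 0) (h : ∀ j, D j t / t = D j R) :
      IsElementaryTower D (F ⊔ IntermediateField.adjoin (RatXY C) {t})
  | logarithm (F : IntermediateField (RatXY C) L) (t R : L) (hF : IsElementaryTower D F)
      (hR : R ∈ F) (hR0 : R ≠ 0) (h : ∀ j, D j t = D j R / R) :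
      IsElementaryTower D (F ⊔ IntermediateField.adjoin (RatXY C) {t})
  | algebraic (F F' : IntermediateField (RatXY C) L) (hF : IsElementaryTower D F) (h : F ≤ F')
      (hfin : FiniteDimensional F (IntermediateField.extendScalars h)) :
      IsElementaryTower D F'

/-- `L`, with the derivations `D 0, D 1`, is an elementary extension of `K = C(x, y)`: it is a
differential extension field of `K` with the same constants, reached by an elementary tower. -/
def IsElementaryExtension (D : Fin 2 → Derivation C L L) : Prop :=
  IsDifferentialExtension D ∧
    (∀ f : L, IsConstant D f → ∃ a : RatXY C, algebraMap (RatXY C) L a = f) ∧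
    IsElementaryTower D (⊤ : IntermediateField (RatXY C) L)

end Extension

section VectorFields

variable {C : Type u} [Field C]

/-- `X` has an elementary first integral: some elementary extension of `C(x, y)` contains a
first integral of `X`. -/
def HasElementaryFirstIntegral (X : Fin 2 → RatXY C) : Prop :=
  ∃ (L : Type u) (_ : Field L) (_ : Algebra C L) (_ : Algebra (RatXY C) L)
    (_ : IsScalarTower C (RatXY C) L) (D : Fin 2 → Derivation C L L),
    IsElementaryExtension D ∧ ∃ f : L, IsFirstIntegral D X f

/-- `X` has a rational first integral. -/
def HasRationalFirstIntegral (X : Fin 2 → RatXY C) : Prop :=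
  ∃ f : RatXY C, IsFirstIntegral (partialDeriv C) X f

/-- `X` is exceptional: it has an elementary first integral, but there is no relation
`(∑ i, c i * d(u i) / u i + dv) ∧ ω = 0` with nonzero first factor and all `u i` and `v`
in `K = C(x, y)` itself. -/
def IsExceptional (X : Fin 2 → RatXY C) : Prop :=
  HasElementaryFirstIntegral X ∧ ¬ HasLogRelation (partialDeriv C) X

/-- `k ∈ K = C(x, y)` is not a square in `K` but has a square root in `L`. For an extension `L`
of degree two this means `L = K(√k)`. -/
def IsQuadraticGenerator (L : Type*) [Field L] [Algebra (RatXY C) L] (k : RatXY C) : Prop :=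
  ¬ IsSquare k ∧ ∃ l : L, l ^ 2 = algebraMap (RatXY C) L k

/-- The explicit vector field `H` built from `k`, `h`, constants `c i` and rational functions
`g i`; here `dx` and `dy` denote the partial derivatives with respect to `x` and `y`. -/
def quadField (k h : RatXY C) {m : ℕ} (c : Fin m → C) (g : Fin m → RatXY C) :
    Fin 2 → RatXY C :=
  let dx := partialDeriv C 0
  let dy := partialDeriv C 1
  ![-(dy h + 1 / 2 * h * (dy k / k)), dx h + 1 / 2 * h * (dx k / k)] +
    ∑ i, (c i • (1 / (g i ^ 2 - k) ^ 2)) •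
      ![-2 * (-(g i ^ 2) * dy (g i) + k * dy (g i) - g i * dy k)
          - g i * (g i ^ 2 + k) * (dy k / k),
        2 * (-(g i ^ 2) * dx (g i) + k * dx (g i) - g i * dx k)
          + g i * (g i ^ 2 + k) * (dx k / k)]

end VectorFields

end PlaneVF

end

/-
Write `σ` for the nontrivial automorphism of `K(√k)` over `K`. Twice a logarithmic form over `K(√k)`
is the sum of a `σ`-invariant form, which is a logarithmic form over `K`, and a form that changes
sign, which is `√k γ` with `γ` a one-form over `K`. Since `u / σ u` has the shape
`(g + √k) / (g - √k)`, the form `√k γ` is the differential of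
`h√k + ∑ i, c i * log ((g i + √k) / (g i - √k))`, and the vector field `H` is the dual field
`-γ₁ ∂/∂x + γ₀ ∂/∂y` of `γ`. If `X` has no logarithmic relation over `K`, the invariant part of its
relation over `K(√k)` vanishes; hence `X` annihilates `γ` and is a multiple of `H`.

Conversely `√k γ` is integrated by adjoining logarithms to `K(√k)`, which can be done without new
constants: either a primitive is already present or it is transcendental, and then a new constant
would make it present. A logarithmic relation of `H` over `K` is a closed form `wγ`; the quotient
`w / √k` of the two closed forms `wγ` and `√k γ` is killed by `H`, and so is `w² / k ∈ K`. This is a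
rational first integral, because `k` is not a square, even up to constants.
-/

noncomputable section

namespace PlaneVF

section ExtendingDerivations

variable {C A B : Type*} [CommRing C] [CommRing A] [CommRing B] [Algebra C B] [Algebra A B]

theorem derivation_eq_zero_of_algebraMap [Algebra.FormallyUnramified A B] {D : Derivation C B B}
    (hD : ∀ a, D (algebraMap A B a) = 0) (b : B) : D b = 0 := by
  let D' : Derivation A B B :=
    Derivation.mk' { toFun := D, map_add' := map_add D,
                     map_smul' := fun a b => by simp [Algebra.smul_def, hD] } D.leibniz
  have : Subsingleton (Derivation A B B) :=
    (KaehlerDifferential.linearMapEquivDerivation A B).symm.injective.subsingleton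
  exact DFunLike.congr_fun (Subsingleton.elim D' 0) b

variable [Algebra C A]

theorem exists_derivation_extension [IsScalarTower C A B] [Algebra.FormallyEtale A B]
    (d : Derivation C A B) : ∃ D : Derivation C B B, ∀ a, D (algebraMap A B a) = d a := by
  refine ⟨(d.liftKaehlerDifferential.liftBaseChange B ∘ₗ
    (KaehlerDifferential.tensorKaehlerEquivOfFormallyEtale C A B).symm.toLinearMap).compDer
    (KaehlerDifferential.D C B), fun a => ?_⟩
  simp [KaehlerDifferential.tensorKaehlerEquivOfFormallyEtale_symm_D_algebraMap]

theorem derivation_comm_of_extends [Algebra.FormallyUnramified A B]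
    {d : Fin 2 → Derivation C A A} {D : Fin 2 → Derivation C B B}
    (hD : ∀ j a, D j (algebraMap A B a) = algebraMap A B (d j a))
    (hd : ∀ a, d 0 (d 1 a) = d 1 (d 0 a)) (b : B) : D 0 (D 1 b) = D 1 (D 0 b) := by
  have hbracket : ⁅D 0, D 1⁆ b = 0 := derivation_eq_zero_of_algebraMap (A := A)
    (fun a => by simp only [Derivation.commutator_apply, hD, hd, sub_self]) b
  rwa [Derivation.commutator_apply, sub_eq_zero] at hbracket

theorem exists_commuting_extension [IsScalarTower C A B] [Algebra.FormallyEtale A B]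
    (d : Fin 2 → Derivation C A A) (hd : ∀ a, d 0 (d 1 a) = d 1 (d 0 a)) :
    ∃ D : Fin 2 → Derivation C B B,
      (∀ j a, D j (algebraMap A B a) = algebraMap A B (d j a)) ∧
        ∀ b, D 0 (D 1 b) = D 1 (D 0 b) := by
  choose D hD using fun j =>
    exists_derivation_extension (B := B) ((Algebra.linearMap A B).compDer (d j))
  exact ⟨D, hD, derivation_comm_of_extends hD hd⟩

end ExtendingDerivations

section FractionFieldConstants

variable {C A K ι : Type*} [CommRing C] [CommRing A] [IsDomain A] [UniqueFactorizationMonoid A]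
  [Field K] [Algebra C A] [Algebra C K] [Algebra A K] [IsFractionRing A K]

/- The denominator `b` of a constant in lowest terms satisfies `b ∣ d j b`: it is a Darboux element
of `A`. -/
theorem exists_algebraMap_eq_of_forall_derivation_eq_zero {d : ι → Derivation C A A}
    {D : ι → Derivation C K K} (hD : ∀ j a, D j (algebraMap A K a) = algebraMap A K (d j a))
    (hunit : ∀ b : A, b ≠ 0 → (∀ j, b ∣ d j b) → IsUnit b) {f : K} (hf : ∀ j, D j f = 0) :
    ∃ a : A, (∀ j, d j a = 0) ∧ algebraMap A K a = f := by
  obtain ⟨a, b, hab, rfl⟩ := IsFractionRing.exists_reduced_fraction A f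
  have hb : algebraMap A K b ≠ 0 := by simp
  have hdvd : ∀ j, (b : A) ∣ d j b := fun j => by
    have hquot := hf j
    rw [IsFractionRing.mk'_eq_div, Derivation.leibniz_div, smul_eq_mul, mul_eq_zero,
      or_iff_right (pow_ne_zero 2 (inv_ne_zero hb)), sub_eq_zero, hD, hD, smul_eq_mul, smul_eq_mul,
      ← map_mul, ← map_mul] at hquot
    exact hab.symm.dvd_of_dvd_mul_left ⟨_, (IsFractionRing.injective A K hquot).symm⟩
  obtain ⟨u, hu⟩ := hunit b (nonZeroDivisors.coe_ne_zero b) hdvd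
  have hfrac : algebraMap A K (a * ↑u⁻¹) = IsLocalization.mk' K a b := by
    rw [IsLocalization.eq_mk'_iff_mul_eq, ← map_mul, ← hu, Units.inv_mul_cancel_right]
  refine ⟨a * ↑u⁻¹, fun j => IsFractionRing.injective A K ?_, hfrac⟩
  rw [← hD, hfrac, hf, map_zero]

end FractionFieldConstants

section PartialDerivatives

variable {σ R : Type*}

theorem pderiv_comm [CommRing R] (i j : σ) (p : MvPolynomial σ R) :
    MvPolynomial.pderiv i (MvPolynomial.pderiv j p) =
      MvPolynomial.pderiv j (MvPolynomial.pderiv i p) := by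
  classical
  have hbracket : ⁅(MvPolynomial.pderiv i : Derivation R (MvPolynomial σ R) _),
      (MvPolynomial.pderiv j : Derivation R (MvPolynomial σ R) _)⁆ = 0 :=
    MvPolynomial.derivation_ext fun l => by
      simp [Derivation.commutator_apply, MvPolynomial.pderiv_X, Pi.single_apply, apply_ite]
  rw [← sub_eq_zero, ← Derivation.commutator_apply, hbracket, Derivation.zero_apply]

theorem totalDegree_pderiv_lt [CommSemiring R] {j : σ} {p : MvPolynomial σ R}
    (hp : MvPolynomial.pderiv j p ≠ 0) :
    (MvPolynomial.pderiv j p).totalDegree < p.totalDegree := by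
  obtain ⟨m, hm, hdeg⟩ := Finset.exists_mem_eq_sup _ (MvPolynomial.support_nonempty.2 hp)
    fun s => s.sum fun _ e => e
  rw [MvPolynomial.mem_support_iff, MvPolynomial.coeff_pderiv] at hm
  have hle := MvPolynomial.le_totalDegree
    (MvPolynomial.mem_support_iff.2 (left_ne_zero_of_mul hm))
  rw [Finsupp.sum_add_index' (by simp) (by simp), Finsupp.sum_single_index rfl] at hle
  rw [MvPolynomial.totalDegree, hdeg]
  exact hle

theorem pderiv_eq_zero_of_dvd [CommRing R] [IsDomain R] {j : σ} {p : MvPolynomial σ R}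
    (h : p ∣ MvPolynomial.pderiv j p) : MvPolynomial.pderiv j p = 0 := by
  by_contra hne
  obtain ⟨q, hq⟩ := h
  have hlt := totalDegree_pderiv_lt hne
  rw [hq] at hne hlt
  rw [MvPolynomial.totalDegree_mul_of_isDomain (left_ne_zero_of_mul hne)
    (right_ne_zero_of_mul hne)] at hlt
  omega

theorem eq_C_of_pderiv_eq_zero [CommSemiring R] [NoZeroDivisors R] [CharZero R]
    {p : MvPolynomial σ R} (h : ∀ j, MvPolynomial.pderiv j p = 0) :
    p = MvPolynomial.C (p.coeff 0) := by
  classical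
  ext m
  rw [MvPolynomial.coeff_C]
  split_ifs with hm
  · rw [hm]
  obtain ⟨j, hj⟩ : ∃ j, m j ≠ 0 := by
    by_contra! hzero
    exact hm (Finsupp.ext fun j => (hzero j).symm)
  have hcoeff := congrArg (MvPolynomial.coeff (m - Finsupp.single j 1)) (h j)
  rw [MvPolynomial.coeff_pderiv, MvPolynomial.coeff_zero,
    tsub_add_cancel_of_le (by simpa [Nat.one_le_iff_ne_zero] using hj), mul_eq_zero] at hcoeff
  exact hcoeff.resolve_right (Nat.cast_add_one_ne_zero _)

theorem isUnit_of_dvd_pderiv [Field R] [CharZero R] {p : MvPolynomial σ R} (hp : p ≠ 0)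
    (h : ∀ j, p ∣ MvPolynomial.pderiv j p) : IsUnit p := by
  have hC := eq_C_of_pderiv_eq_zero fun j => pderiv_eq_zero_of_dvd (h j)
  rw [hC] at hp ⊢
  exact (Ne.isUnit (by simpa using hp)).map MvPolynomial.C

end PartialDerivatives

section RationalFunctions

variable {C : Type*} [Field C]

theorem partialDeriv_comm (f : RatXY C) :
    partialDeriv C 0 (partialDeriv C 1 f) = partialDeriv C 1 (partialDeriv C 0 f) := by
  have : Algebra.FormallyUnramified (MvPolynomial (Fin 2) C) (RatXY C) :=
    Algebra.FormallyUnramified.of_isLocalization (nonZeroDivisors (MvPolynomial (Fin 2) C))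
  exact derivation_comm_of_extends (partialDeriv_algebraMap C) (pderiv_comm 0 1) f

theorem exists_algebraMap_eq_of_isConstant [CharZero C] {f : RatXY C}
    (hf : IsConstant (partialDeriv C) f) : ∃ a : C, algebraMap C (RatXY C) a = f := by
  obtain ⟨p, hp, rfl⟩ := exists_algebraMap_eq_of_forall_derivation_eq_zero
    (partialDeriv_algebraMap C) (fun _ => isUnit_of_dvd_pderiv) hf
  refine ⟨p.coeff 0, ?_⟩
  rw [IsScalarTower.algebraMap_apply C (MvPolynomial (Fin 2) C) (RatXY C),
    MvPolynomial.algebraMap_eq, ← eq_C_of_pderiv_eq_zero hp]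

end RationalFunctions

section LogForms

variable {C F : Type*} [Field C] [Field F] [Algebra C F]

theorem logDeriv_mul (d : Derivation C F F) {u v : F} (hu : u ≠ 0) (hv : v ≠ 0) :
    d (u * v) / (u * v) = d u / u + d v / v :=
  letI : Differential F := ⟨d.restrictScalars ℤ⟩
  Differential.logDeriv_mul u v hu hv

theorem logDeriv_div (d : Derivation C F F) {u v : F} (hu : u ≠ 0) (hv : v ≠ 0) :
    d (u / v) / (u / v) = d u / u - d v / v :=
  letI : Differential F := ⟨d.restrictScalars ℤ⟩
  Differential.logDeriv_div u v hu hv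

/-- The logarithmic derivative as a homomorphism from the multiplicative to the additive group,
so that it takes integral combinations of units to integral combinations. -/
def logDerivHom (d : Derivation C F F) : Additive Fˣ →+ F where
  toFun u := d (u.toMul : F) / (u.toMul : F)
  map_zero' := by simp
  map_add' u v := logDeriv_mul d u.toMul.ne_zero v.toMul.ne_zero

theorem logDeriv_closed {D : Fin 2 → Derivation C F F} (hD : ∀ f, D 0 (D 1 f) = D 1 (D 0 f))
    (u : F) : D 0 (D 1 u / u) = D 1 (D 0 u / u) := by
  rw [Derivation.leibniz_div, Derivation.leibniz_div, hD]
  simp only [smul_eq_mul]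
  ring

theorem logForm_closed {D : Fin 2 → Derivation C F F} (hD : ∀ f, D 0 (D 1 f) = D 1 (D 0 f))
    {m : ℕ} (c : Fin m → C) (u : Fin m → F) (v : F) :
    D 0 (logForm D c u v 1) = D 1 (logForm D c u v 0) := by
  simp only [logForm, map_add, map_sum, Derivation.map_smul, hD, logDeriv_closed hD]

/- Expanding the `c i` in a `ℤ`-basis of the group they generate turns the `u i` into monomials in
the `u i` with integer exponents. -/
theorem exists_logForm_eq_linearIndependent [CharZero C] (D : Fin 2 → Derivation C F F) {m : ℕ}
    (c : Fin m → C) {u : Fin m → F} (hu : ∀ i, u i ≠ 0) (v : F) :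
    ∃ (n : ℕ) (c' : Fin n → C) (u' : Fin n → F), LinearIndependent ℚ c' ∧ (∀ i, u' i ≠ 0) ∧
      logForm D c u v = logForm D c' u' v := by
  let S := Submodule.span ℤ (Set.range c)
  have : Module.Finite ℤ S := Module.Finite.span_of_finite ℤ (Set.finite_range c)
  let e := Module.finBasis ℤ S
  let N i := e.repr ⟨c i, Submodule.subset_span ⟨i, rfl⟩⟩
  have hN : ∀ i, c i = ∑ l, N i l • (e l : C) := fun i => by
    simpa only [Submodule.coe_sum, Submodule.coe_smul] using
      congrArg Subtype.val (e.sum_repr ⟨c i, Submodule.subset_span ⟨i, rfl⟩⟩).symm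
  let U i := Additive.ofMul (Units.mk0 (u i) (hu i))
  let W l := ∑ i, N i l • U i
  have hW : ∀ d : Derivation C F F,
      ∑ i, c i • logDerivHom d (U i) = ∑ l, (e l : C) • logDerivHom d (W l) := by
    intro d
    simp only [W, map_sum, map_zsmul, Finset.smul_sum, hN, Finset.sum_smul]
    rw [Finset.sum_comm]
    exact Finset.sum_congr rfl fun l _ => Finset.sum_congr rfl fun i _ => by
      rw [smul_assoc, smul_comm]
  refine ⟨_, fun l => (e l : C), fun l => (W l).toMul, ?_, fun l => Units.ne_zero _, ?_⟩
  · rw [← LinearIndependent.iff_fractionRing ℤ ℚ]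
    exact e.linearIndependent.map' S.subtype S.ker_subtype
  · exact funext fun j => congrArg (· + D j v) (hW (D j))

end LogForms

section QuadraticExtension

variable {K F : Type*} [Field K] [Field F] [Algebra K F]

theorem exists_add_mul_eq [Algebra.IsQuadraticExtension K F] {s : F}
    (hs : s ∉ Set.range (algebraMap K F)) (x : F) :
    ∃ a b, x = algebraMap K F a + algebraMap K F b * s := by
  have hli : LinearIndependent K ![1, s] := by
    rw [LinearIndependent.pair_iff' one_ne_zero]
    exact fun a ha => hs ⟨a, by rwa [Algebra.algebraMap_eq_smul_one]⟩
  have hspan : x ∈ Submodule.span K (Set.range ![1, s]) :=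
    hli.span_eq_top_of_card_eq_finrank (Algebra.IsQuadraticExtension.finrank_eq_two K F).symm ▸
      Submodule.mem_top
  rw [Matrix.range_cons_cons_empty, Submodule.mem_span_pair] at hspan
  obtain ⟨a, b, rfl⟩ := hspan
  exact ⟨a, b, by rw [Algebra.smul_def, Algebra.smul_def, mul_one]⟩

theorem add_mul_eq_zero_iff {s : F} (hs : s ∉ Set.range (algebraMap K F)) {a b : K} :
    algebraMap K F a + algebraMap K F b * s = 0 ↔ a = 0 ∧ b = 0 := by
  refine ⟨fun h => ?_, by rintro ⟨rfl, rfl⟩; simp⟩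
  obtain rfl : b = 0 := by
    by_contra hb
    refine hs ⟨-a / b, ?_⟩
    rw [map_div₀, map_neg, div_eq_iff (by simpa using hb)]
    linear_combination -h
  simpa using h

theorem sqrt_notMem_range {k : K} (hk : ¬ IsSquare k) {s : F} (hs : s ^ 2 = algebraMap K F k) :
    s ∉ Set.range (algebraMap K F) := by
  rintro ⟨a, rfl⟩
  rw [← map_pow, (algebraMap K F).injective.eq_iff] at hs
  exact hk (hs ▸ IsSquare.sq a)

variable (K F) in
theorem exists_sqrt_generator [NeZero (2 : K)] [Algebra.IsQuadraticExtension K F] :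
    ∃ k : K, ¬ IsSquare k ∧ ∃ s : F, s ^ 2 = algebraMap K F k := by
  obtain ⟨x, hx⟩ : ∃ x, x ∉ Set.range (algebraMap K F) := by
    by_contra! hsurj
    have hbot := Subalgebra.bot_eq_top_iff_finrank_eq_one.1
      (eq_top_iff.2 fun x _ => Algebra.mem_bot.2 (hsurj x) : (⊥ : Subalgebra K F) = ⊤)
    rw [Algebra.IsQuadraticExtension.finrank_eq_two K F] at hbot
    omega
  obtain ⟨p, q, hpq⟩ := exists_add_mul_eq hx (x ^ 2)
  have htwo : (2 : K) ≠ 0 := two_ne_zero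
  have hsq : (x - algebraMap K F (q / 2)) ^ 2 = algebraMap K F (p + (q / 2) ^ 2) := by
    have hq : algebraMap K F q = 2 * algebraMap K F (q / 2) := by
      rw [← map_ofNat (algebraMap K F), ← map_mul, mul_div_cancel₀ _ htwo]
    rw [map_add, map_pow]
    linear_combination hpq + x * hq
  refine ⟨_, ?_, _, hsq⟩
  rintro ⟨l, hl⟩
  rw [hl, ← pow_two, map_pow, sq_eq_sq_iff_eq_or_eq_neg] at hsq
  rcases hsq with hsq | hsq
  · exact hx ⟨l + q / 2, by rw [map_add, ← hsq, sub_add_cancel]⟩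
  · exact hx ⟨-l + q / 2, by rw [map_add, map_neg, ← hsq, sub_add_cancel]⟩

end QuadraticExtension

section SqrtForms

variable {C K F : Type*} [Field C] [Field K] [Algebra C K] [Field F] [Algebra C F] [Algebra K F]

/-- The logarithmic derivative of `(g + √k) / (g - √k)`, divided by `√k`. -/
def sqrtLogDeriv (d : Derivation C K K) (k g : K) : K :=
  (g * (d k / k) - 2 * d g) / (g ^ 2 - k)

/-- The differential of `h√k + ∑ i, c i * log ((g i + √k) / (g i - √k))`, divided by `√k`: the
one-forms that the nontrivial automorphism of `K(√k)` changes the sign of are `√k` times these. -/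
def sqrtForm (d : Fin 2 → Derivation C K K) (k h : K) {m : ℕ} (c : Fin m → C) (g : Fin m → K) :
    Fin 2 → K :=
  fun j => d j h + 1 / 2 * h * (d j k / k) + ∑ i, c i • sqrtLogDeriv (d j) k (g i)

theorem sq_sub_ne_zero {k : K} (hk : ¬ IsSquare k) (g : K) : g ^ 2 - k ≠ 0 := fun h =>
  hk (sub_eq_zero.1 h ▸ IsSquare.sq g)

theorem sq_sub_mul_sq_ne_zero {k : K} (hk : ¬ IsSquare k) {s : F} (hs : s ^ 2 = algebraMap K F k)
    {a b : K} (hab : algebraMap K F a + algebraMap K F b * s ≠ 0) : a ^ 2 - k * b ^ 2 ≠ 0 := by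
  intro hN
  have hb : b = 0 := by
    by_contra hb
    refine sq_sub_ne_zero hk (a / b) ?_
    rw [div_pow, sub_eq_zero, div_eq_iff (pow_ne_zero 2 hb)]
    linear_combination hN
  have ha : a = 0 := by simpa [hb] using hN
  exact hab ((add_mul_eq_zero_iff (sqrt_notMem_range hk hs)).2 ⟨ha, hb⟩)

theorem add_sqrt_ne_zero {k : K} (hk : ¬ IsSquare k) {s : F} (hs : s ^ 2 = algebraMap K F k)
    (g : K) : algebraMap K F g + s ≠ 0 := fun h =>
  sqrt_notMem_range hk hs ⟨-g, by rw [map_neg, eq_neg_of_add_eq_zero_right h]⟩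

theorem sub_sqrt_ne_zero {k : K} (hk : ¬ IsSquare k) {s : F} (hs : s ^ 2 = algebraMap K F k)
    (g : K) : algebraMap K F g - s ≠ 0 := fun h =>
  sqrt_notMem_range hk hs ⟨g, sub_eq_zero.1 h⟩

variable [NeZero (2 : K)]

theorem derivation_sqrt {d : Derivation C K K} {D : Derivation C F F}
    (hD : ∀ a, D (algebraMap K F a) = algebraMap K F (d a)) {k : K} {s : F}
    (hs : s ^ 2 = algebraMap K F k) : D s = s * algebraMap K F (1 / 2 * (d k / k)) := by
  by_cases hs0 : s = 0
  · simp [hs0]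
  have htwo : (2 : F) ≠ 0 := map_ofNat (algebraMap K F) 2 ▸ (map_ne_zero _).2 two_ne_zero
  have hdk : algebraMap K F (d k) = 2 * s * D s := by
    rw [← hD, ← hs, Derivation.leibniz_pow]
    simp [mul_assoc]
  simp only [map_mul, map_div₀, map_one, map_ofNat, hdk, ← hs]
  field_simp

theorem derivation_mul_sqrt {d : Derivation C K K} {D : Derivation C F F}
    (hD : ∀ a, D (algebraMap K F a) = algebraMap K F (d a)) {k : K} {s : F}
    (hs : s ^ 2 = algebraMap K F k) (h : K) :
    D (algebraMap K F h * s) = algebraMap K F (d h + 1 / 2 * h * (d k / k)) * s := by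
  rw [Derivation.leibniz, hD, derivation_sqrt hD hs]
  simp only [smul_eq_mul, map_add, map_mul]
  ring

theorem logDeriv_add_sqrt_div_sub_sqrt {d : Derivation C K K} {D : Derivation C F F}
    (hD : ∀ a, D (algebraMap K F a) = algebraMap K F (d a)) {k : K} (hk : ¬ IsSquare k) {s : F}
    (hs : s ^ 2 = algebraMap K F k) (g : K) :
    D ((algebraMap K F g + s) / (algebraMap K F g - s)) /
        ((algebraMap K F g + s) / (algebraMap K F g - s)) =
      algebraMap K F (sqrtLogDeriv d k g) * s := by
  have hadd := add_sqrt_ne_zero hk hs g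
  have hsub := sub_sqrt_ne_zero hk hs g
  have htwo : (2 : F) ≠ 0 := map_ofNat (algebraMap K F) 2 ▸ (map_ne_zero _).2 two_ne_zero
  have hnorm : algebraMap K F g ^ 2 - algebraMap K F k =
      (algebraMap K F g + s) * (algebraMap K F g - s) := by rw [← hs]; ring
  rw [logDeriv_div D hadd hsub, map_add, map_sub, hD, derivation_sqrt hD hs]
  simp only [sqrtLogDeriv, map_div₀, map_sub, map_mul, map_pow, map_ofNat, map_one, hnorm]
  field_simp
  ring

/- For `u = a + b√k` of norm `N` and conjugate `u'` one has `u² = N * (u / u')`. When `b = 0`, the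
junk value `a / b = 0` turns `u / u'` into `-1`, and the identity holds up to a sign. -/
theorem two_mul_logDeriv_add_mul_sqrt {d : Derivation C K K} {D : Derivation C F F}
    (hD : ∀ a, D (algebraMap K F a) = algebraMap K F (d a)) {k : K} (hk : ¬ IsSquare k) {s : F}
    (hs : s ^ 2 = algebraMap K F k) {a b : K}
    (hab : algebraMap K F a + algebraMap K F b * s ≠ 0) :
    2 * (D (algebraMap K F a + algebraMap K F b * s) /
        (algebraMap K F a + algebraMap K F b * s)) =
      algebraMap K F (d (a ^ 2 - k * b ^ 2) / (a ^ 2 - k * b ^ 2)) +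
        algebraMap K F (sqrtLogDeriv d k (a / b)) * s := by
  set u := algebraMap K F a + algebraMap K F b * s with hu
  set N := algebraMap K F (a ^ 2 - k * b ^ 2) with hN
  set w := (algebraMap K F (a / b) + s) / (algebraMap K F (a / b) - s) with hw
  have hN0 : N ≠ 0 := (map_ne_zero _).2 (sq_sub_mul_sq_ne_zero hk hs hab)
  have hsub := sub_sqrt_ne_zero hk hs (a / b)
  have hw0 : w ≠ 0 := div_ne_zero (add_sqrt_ne_zero hk hs _) hsub
  have hsq : u * u = N * w ∨ u * u = -(N * w) := by
    rw [hw, ← mul_div_assoc, ← neg_div, eq_div_iff hsub, eq_div_iff hsub]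
    simp only [hu, hN, map_sub, map_mul, map_pow, map_div₀, ← hs]
    rcases eq_or_ne b 0 with rfl | hb
    · exact Or.inr (by simp only [map_zero, div_zero]; ring)
    · have hb : algebraMap K F b ≠ 0 := (map_ne_zero _).2 hb
      exact Or.inl (by field_simp; ring)
  have hlog : D (u * u) / (u * u) = D (N * w) / (N * w) := by
    rcases hsq with h | h <;> simp only [h, map_neg, neg_div_neg_eq]
  rw [two_mul, ← logDeriv_mul D hab hab, hlog, logDeriv_mul D hN0 hw0,
    logDeriv_add_sqrt_div_sub_sqrt hD hk hs, hN, hD, map_div₀]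

variable [IsScalarTower C K F]

theorem logForm_sqrt {d : Fin 2 → Derivation C K K} {D : Fin 2 → Derivation C F F}
    (hD : ∀ j a, D j (algebraMap K F a) = algebraMap K F (d j a)) {k : K} (hk : ¬ IsSquare k)
    {s : F} (hs : s ^ 2 = algebraMap K F k) (h : K) {m : ℕ} (c : Fin m → C) (g : Fin m → K)
    (j : Fin 2) :
    logForm D c (fun i => (algebraMap K F (g i) + s) / (algebraMap K F (g i) - s))
      (algebraMap K F h * s) j = algebraMap K F (sqrtForm d k h c g j) * s := by
  simp only [logForm, sqrtForm, logDeriv_add_sqrt_div_sub_sqrt (hD j) hk hs,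
    derivation_mul_sqrt (hD j) hs, map_add (algebraMap K F) (_ + _), map_sum, add_mul,
    Finset.sum_mul, algebraMap.coe_smul, smul_mul_assoc]
  exact add_comm _ _

theorem two_mul_logForm {d : Fin 2 → Derivation C K K} {D : Fin 2 → Derivation C F F}
    (hD : ∀ j a, D j (algebraMap K F a) = algebraMap K F (d j a)) {k : K} (hk : ¬ IsSquare k)
    {s : F} (hs : s ^ 2 = algebraMap K F k) {m : ℕ} (c : Fin m → C) {a b : Fin m → K}
    (hab : ∀ i, algebraMap K F (a i) + algebraMap K F (b i) * s ≠ 0) (p q : K) (j : Fin 2) :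
    2 * logForm D c (fun i => algebraMap K F (a i) + algebraMap K F (b i) * s)
        (algebraMap K F p + algebraMap K F q * s) j =
      algebraMap K F (logForm d c (fun i => a i ^ 2 - k * b i ^ 2) (2 * p) j) +
        algebraMap K F (sqrtForm d k (2 * q) c (fun i => a i / b i) j) * s := by
  have hdouble : ∀ x : K, d j (2 * x) = 2 * d j x := fun x => by rw [two_mul, two_mul, map_add]
  have hlog : 2 * ∑ i, c i • (D j (algebraMap K F (a i) + algebraMap K F (b i) * s) /
      (algebraMap K F (a i) + algebraMap K F (b i) * s)) =
      algebraMap K F (∑ i, c i • (d j (a i ^ 2 - k * b i ^ 2) / (a i ^ 2 - k * b i ^ 2))) +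
        algebraMap K F (∑ i, c i • sqrtLogDeriv (d j) k (a i / b i)) * s := by
    simp only [Finset.mul_sum, mul_smul_comm, two_mul_logDeriv_add_mul_sqrt (hD j) hk hs (hab _),
      smul_add, Finset.sum_add_distrib, map_sum, algebraMap.coe_smul, Finset.sum_mul,
      smul_mul_assoc]
  simp only [logForm, sqrtForm]
  rw [mul_add, hlog, map_add (D j), hD, derivation_mul_sqrt (hD j) hs, hdouble, hdouble]
  simp only [map_add, map_mul, map_ofNat]
  ring

end SqrtForms

section DualField

variable {K : Type*} [Field K]

/-- The vector field `-γ₁ ∂/∂x + γ₀ ∂/∂y`, which spans the kernel of the one-form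
`γ₀ dx + γ₁ dy` when the latter is not zero. -/
def dualField (γ : Fin 2 → K) : Fin 2 → K := ![-γ 1, γ 0]

theorem dualField_zero : dualField (0 : Fin 2 → K) = 0 := by
  funext j
  fin_cases j <;> simp [dualField]

theorem sum_dualField_mul (γ : Fin 2 → K) : ∑ j, dualField γ j * γ j = 0 := by
  simp only [dualField, Fin.sum_univ_two, Matrix.cons_val_zero, Matrix.cons_val_one]
  ring

theorem dualField_dualField (γ : Fin 2 → K) : dualField (dualField γ) = -γ := by
  funext j
  fin_cases j <;> simp [dualField]

theorem exists_eq_smul_dualField {γ X : Fin 2 → K} (hγ : γ ≠ 0) (h : ∑ j, X j * γ j = 0) :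
    ∃ r : K, X = r • dualField γ := by
  rw [Fin.sum_univ_two] at h
  by_cases h0 : γ 0 = 0
  · have h1 : γ 1 ≠ 0 := fun h1 => hγ (funext fun j => by fin_cases j <;> assumption)
    have hX1 : X 1 = 0 := by simpa [h0, h1] using h
    refine ⟨-X 0 / γ 1, funext fun j => ?_⟩
    fin_cases j <;> simp [dualField, h0, h1, hX1]
  · refine ⟨X 1 / γ 0, funext fun j => ?_⟩
    fin_cases j
    · simp only [dualField, Fin.zero_eta, Pi.smul_apply, Matrix.cons_val_zero, smul_eq_mul]
      field_simp
      linear_combination h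
    · simp [dualField, h0]

theorem exists_eq_smul_of_dualField {γ β : Fin 2 → K} (hγ : γ ≠ 0)
    (h : ∑ j, dualField γ j * β j = 0) : ∃ w : K, β = w • γ := by
  have hdual : dualField γ ≠ 0 := fun hzero => hγ <| by
    rw [← neg_eq_zero, ← dualField_dualField, hzero, dualField_zero]
  obtain ⟨r, hr⟩ := exists_eq_smul_dualField (X := β) hdual (by simpa only [mul_comm] using h)
  exact ⟨-r, by rw [hr, dualField_dualField, smul_neg, neg_smul]⟩

theorem quadField_eq_dualField {C : Type*} [Field C] {k : RatXY C} (hk : ¬ IsSquare k)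
    (h : RatXY C) {m : ℕ} (c : Fin m → C) (g : Fin m → RatXY C) :
    quadField k h c g = dualField (sqrtForm (partialDeriv C) k h c g) := by
  have hk0 : k ≠ 0 := by
    rintro rfl
    exact hk IsSquare.zero
  have hterm : ∀ (j : Fin 2) (g : RatXY C), 1 / (g ^ 2 - k) ^ 2 *
      (2 * (-(g ^ 2) * partialDeriv C j g + k * partialDeriv C j g - g * partialDeriv C j k)
        + g * (g ^ 2 + k) * (partialDeriv C j k / k)) = sqrtLogDeriv (partialDeriv C j) k g := by
    intro j g
    have hgk := sq_sub_ne_zero hk g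
    rw [sqrtLogDeriv]
    field_simp
    ring
  funext j
  fin_cases j
  · simp only [quadField, dualField, sqrtForm, ← hterm, Pi.add_apply, Finset.sum_apply,
      Pi.smul_apply, Fin.zero_eta, Matrix.cons_val_zero, smul_eq_mul, neg_add,
      ← Finset.sum_neg_distrib, smul_mul_assoc, ← smul_neg, ← mul_neg]
    congr! 4
    ring
  · simp only [quadField, dualField, sqrtForm, ← hterm, Pi.add_apply, Finset.sum_apply,
      Pi.smul_apply, Fin.mk_one, Matrix.cons_val_one, Matrix.cons_val_fin_one, smul_eq_mul,
      smul_mul_assoc]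

end DualField

section NecessityOfTheForm

variable {C L : Type*} [Field C] [CharZero C] [Field L] [Algebra C L] [Algebra (RatXY C) L]
  [IsScalarTower C (RatXY C) L] [Algebra.IsQuadraticExtension (RatXY C) L]

/- The trace part of a logarithmic relation over `K(√k)` is a logarithmic relation over `K`, so it
vanishes and only the part proportional to `√k` remains. -/
theorem exists_eq_smul_quadField {D : Fin 2 → Derivation C L L}
    (hD : ∀ j f, D j (algebraMap (RatXY C) L f) = algebraMap (RatXY C) L (partialDeriv C j f))
    {X : Fin 2 → RatXY C} (hX : ¬ HasLogRelation (partialDeriv C) X) (hXL : HasLogRelation D X)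
    {k : RatXY C} (hk : ¬ IsSquare k) {s : L} (hs : s ^ 2 = algebraMap (RatXY C) L k) :
    ∃ (r h : RatXY C) (m : ℕ) (c : Fin m → C) (g : Fin m → RatXY C),
      LinearIndependent ℚ c ∧ X = r • quadField k h c g := by
  obtain ⟨n, c₀, u₀, v, hu₀, hβ, hXβ⟩ := hXL
  obtain ⟨m, c, u, hc, hu, heq⟩ := exists_logForm_eq_linearIndependent D c₀ hu₀ v
  rw [heq] at hβ hXβ
  have hs' := sqrt_notMem_range hk hs
  choose a b hab using fun i => exists_add_mul_eq hs' (u i)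
  obtain ⟨p, q, rfl⟩ := exists_add_mul_eq hs' v
  obtain rfl : u = _ := funext hab
  let N i := a i ^ 2 - k * b i ^ 2
  let α := logForm (partialDeriv C) c N (2 * p)
  let γ := sqrtForm (partialDeriv C) k (2 * q) c fun i => a i / b i
  have hsplit : ∀ j, 2 * logForm D c _ _ j = algebraMap _ L (α j) + algebraMap _ L (γ j) * s :=
    two_mul_logForm hD hk hs c hu p q
  have hXαγ : ∑ j, X j * α j = 0 ∧ ∑ j, X j * γ j = 0 := by
    rw [← add_mul_eq_zero_iff hs', map_sum, map_sum, Finset.sum_mul, ← Finset.sum_add_distrib,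
      ← mul_zero 2, ← hXβ, Finset.mul_sum]
    refine Finset.sum_congr rfl fun j _ => ?_
    rw [mul_left_comm, hsplit, map_mul, map_mul]
    ring
  have hα : α = 0 := by
    by_contra hα
    exact hX ⟨m, c, N, 2 * p, fun i => sq_sub_mul_sq_ne_zero hk hs (hu i), hα, hXαγ.1⟩
  have hγ : γ ≠ 0 := fun hγ => hβ <| funext fun j => by
    have : CharZero L := charZero_of_injective_algebraMap (algebraMap C L).injective
    simpa [hα, hγ] using hsplit j
  obtain ⟨r, hr⟩ := exists_eq_smul_dualField hγ hXαγ.2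
  exact ⟨r, 2 * q, m, c, _, hc, by rw [hr, quadField_eq_dualField hk]⟩

end NecessityOfTheForm

section SqrtExtension

open Polynomial in
theorem exists_sqrt_extension {C : Type*} {K : Type u} [Field C] [Field K] [CharZero K]
    [Algebra C K] {d : Fin 2 → Derivation C K K} (hd : ∀ f, d 0 (d 1 f) = d 1 (d 0 f)) {k : K}
    (hk : ¬ IsSquare k) :
    ∃ (F : Type u) (_ : Field F) (_ : Algebra C F) (_ : Algebra K F) (_ : IsScalarTower C K F)
      (_ : Algebra.IsQuadraticExtension K F) (D : Fin 2 → Derivation C F F) (s : F),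
      (∀ j a, D j (algebraMap K F a) = algebraMap K F (d j a)) ∧
        (∀ f, D 0 (D 1 f) = D 1 (D 0 f)) ∧ s ^ 2 = algebraMap K F k := by
  let p : K[X] := X ^ 2 - Polynomial.C k
  have hirr : Irreducible p :=
    (X_pow_sub_C_irreducible_iff_of_prime Nat.prime_two).2 fun b hb => hk (hb ▸ IsSquare.sq b)
  have := Fact.mk hirr
  let pb := AdjoinRoot.powerBasis hirr.ne_zero
  have : Module.Finite K (AdjoinRoot p) := pb.finite
  have : Algebra.FormallyEtale K (AdjoinRoot p) := Algebra.FormallyEtale.of_isSeparable _ _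
  have hrank : Module.finrank K (AdjoinRoot p) = 2 := by
    rw [pb.finrank, AdjoinRoot.powerBasis_dim, natDegree_X_pow_sub_C]
  obtain ⟨D, hD, hDcomm⟩ := exists_commuting_extension (B := AdjoinRoot p) d hd
  have hroot : AdjoinRoot.root p ^ 2 - AdjoinRoot.of p k = 0 := by
    simpa only [p, eval₂_sub, eval₂_X_pow, eval₂_C] using AdjoinRoot.eval₂_root p
  exact ⟨AdjoinRoot p, inferInstance, inferInstance, inferInstance, inferInstance, ⟨hrank⟩, D,
    AdjoinRoot.root p, hD, hDcomm, sub_eq_zero.1 hroot⟩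

variable {C K : Type*} [Field C] [Field K] [Algebra C K] {d : Fin 2 → Derivation C K K}

theorem exists_algebraMap_eq_of_isConstant_sqrt [NeZero (2 : K)] {F : Type*} [Field F]
    [Algebra C F] [Algebra K F] [Algebra.IsQuadraticExtension K F] {D : Fin 2 → Derivation C F F}
    (hD : ∀ j a, D j (algebraMap K F a) = algebraMap K F (d j a)) {k : K} {s : F}
    (hs : s ^ 2 = algebraMap K F k) (hk : ∀ e, IsConstant d e → e ≠ 0 → ¬ IsSquare (e * k)) {x : F}
    (hx : IsConstant D x) : ∃ a : K, algebraMap K F a = x := by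
  have hksq : ¬ IsSquare k := by simpa using hk 1 (fun j => (d j).map_one_eq_zero) one_ne_zero
  have hs' := sqrt_notMem_range hksq hs
  have hk0 : k ≠ 0 := by
    rintro rfl
    exact hksq IsSquare.zero
  obtain ⟨a, b, rfl⟩ := exists_add_mul_eq hs' x
  have hb : ∀ j, d j b + 1 / 2 * b * (d j k / k) = 0 := fun j => by
    have hj := hx j
    rw [map_add, hD, derivation_mul_sqrt (hD j) hs, add_mul_eq_zero_iff hs'] at hj
    exact hj.2
  suffices b = 0 from ⟨a, by simp [this]⟩
  by_contra hb0
  have hconst : IsConstant d (b ^ 2 * k) := fun j => by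
    rw [Derivation.leibniz, Derivation.leibniz_pow]
    have htwo : (2 : K) ≠ 0 := two_ne_zero
    have hbj := hb j
    field_simp at hbj
    simp only [smul_eq_mul, nsmul_eq_mul, Nat.add_one_sub_one, pow_one, Nat.cast_ofNat]
    linear_combination b * hbj
  exact hk _ hconst (mul_ne_zero (pow_ne_zero 2 hb0) hk0) ⟨b * k, by ring⟩

theorem derivation_mul_eq_of_closed {γ : Fin 2 → K} (hγ : d 0 (γ 1) = d 1 (γ 0)) {f : K}
    (hf : d 0 (f * γ 1) = d 1 (f * γ 0)) : d 0 f * γ 1 = d 1 f * γ 0 := by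
  simp only [Derivation.leibniz, smul_eq_mul] at hf
  linear_combination hf - f * hγ

/- Both `√k γ` and `wγ` are closed, so `w / √k` and hence its square are first integrals of the
dual field of `γ`. -/
theorem derivation_sq_div_mul_sqrtForm [CharZero K] (hd : ∀ f, d 0 (d 1 f) = d 1 (d 0 f)) {k : K}
    (hk : ¬ IsSquare k) {h : K} {m : ℕ} {c : Fin m → C} {g : Fin m → K} {w : K}
    (hw : d 0 (w * sqrtForm d k h c g 1) = d 1 (w * sqrtForm d k h c g 0)) :
    d 0 (w ^ 2 / k) * sqrtForm d k h c g 1 = d 1 (w ^ 2 / k) * sqrtForm d k h c g 0 := by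
  obtain ⟨F, _, _, _, _, _, D, s, hD, hDcomm, hs⟩ := exists_sqrt_extension hd hk
  have hs0 : s ≠ 0 := by
    rintro rfl
    exact sqrt_notMem_range hk hs ⟨0, map_zero _⟩
  have hγ := logForm_closed hDcomm c
    (fun i => (algebraMap K F (g i) + s) / (algebraMap K F (g i) - s)) (algebraMap K F h * s)
  simp only [logForm_sqrt hD hk hs] at hγ
  let γ j := algebraMap K F (sqrtForm d k h c g j) * s
  have hwγ : ∀ j, algebraMap K F w / s * γ j = algebraMap K F (w * sqrtForm d k h c g j) :=
    fun j => by simp only [γ, map_mul]; field_simp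
  have hquot : D 0 (algebraMap K F w / s) * γ 1 = D 1 (algebraMap K F w / s) * γ 0 :=
    derivation_mul_eq_of_closed hγ (by rw [hwγ, hwγ, hD, hD, hw])
  have hsq : ∀ j, algebraMap K F (d j (w ^ 2 / k)) =
      2 * (algebraMap K F w / s) * D j (algebraMap K F w / s) := fun j => by
    rw [← hD, map_div₀, ← hs, map_pow, ← div_pow, Derivation.leibniz_pow]
    simp [mul_assoc]
  refine (algebraMap K F).injective (mul_right_cancel₀ hs0 ?_)
  rw [map_mul, map_mul, hsq, hsq]
  linear_combination 2 * (algebraMap K F w / s) * hquot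

end SqrtExtension

section RationalFirstIntegrals

variable {C : Type*} [Field C]

theorem HasRationalFirstIntegral.hasLogRelation {X : Fin 2 → RatXY C}
    (h : HasRationalFirstIntegral X) : HasLogRelation (partialDeriv C) X := by
  obtain ⟨f, hf, hX⟩ := h
  have hform : logForm (partialDeriv C) ![] ![] f = fun j => partialDeriv C j f := by
    funext j
    simp [logForm]
  refine ⟨0, ![], ![], f, fun i => i.elim0, ?_, ?_⟩ <;> rw [hform]
  · exact fun hzero => hf (congrFun hzero)
  · exact hX

theorem hasRationalFirstIntegral_zero : HasRationalFirstIntegral (0 : Fin 2 → RatXY C) := by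
  refine ⟨algebraMap (MvPolynomial (Fin 2) C) _ (MvPolynomial.X 0), fun hconst => ?_,
    by simp [lieDeriv]⟩
  simpa [partialDeriv_algebraMap] using hconst 0

variable [CharZero C]

theorem not_hasLogRelation_quadField {k : RatXY C} (hk : ∀ a : C, a ≠ 0 → ¬ IsSquare (a • k))
    {h : RatXY C} {m : ℕ} {c : Fin m → C} {g : Fin m → RatXY C}
    (hrat : ¬ HasRationalFirstIntegral (quadField k h c g)) :
    ¬ HasLogRelation (partialDeriv C) (quadField k h c g) := by
  have hksq : ¬ IsSquare k := by simpa using hk 1 one_ne_zero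
  have hk0 : k ≠ 0 := by
    rintro rfl
    exact hksq IsSquare.zero
  rw [quadField_eq_dualField hksq] at hrat ⊢
  set γ := sqrtForm (partialDeriv C) k h c g
  rintro ⟨n, a, u, v, -, hβ, hXβ⟩
  have hγ : γ ≠ 0 := fun hγ => hrat (by
    rw [hγ, dualField_zero]
    exact hasRationalFirstIntegral_zero)
  obtain ⟨w, hw⟩ := exists_eq_smul_of_dualField hγ hXβ
  have hw0 : w ≠ 0 := by
    rintro rfl
    exact hβ (by rw [hw, zero_smul])
  refine hrat ⟨w ^ 2 / k, fun hconst => ?_, ?_⟩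
  · obtain ⟨e, he⟩ := exists_algebraMap_eq_of_isConstant hconst
    have he0 : e ≠ 0 := by
      rintro rfl
      rw [map_zero, eq_comm, div_eq_zero_iff, or_iff_left hk0] at he
      exact pow_ne_zero 2 hw0 he
    refine hk e he0 ⟨w, ?_⟩
    rw [Algebra.smul_def, he, div_mul_cancel₀ _ hk0, pow_two]
  · have hclosed := logForm_closed partialDeriv_comm a u v
    rw [hw] at hclosed
    have hfirst := derivation_sq_div_mul_sqrtForm partialDeriv_comm hksq hclosed
    simp only [lieDeriv, dualField, Fin.sum_univ_two, Matrix.cons_val_zero, Matrix.cons_val_one,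
      Algebra.algebraMap_self, RingHom.id_apply]
    linear_combination -hfirst

theorem hasLogRelation_quadField {k : RatXY C} (hk : ¬ IsSquare k) {F : Type*} [Field F]
    [Algebra C F] [Algebra (RatXY C) F] [IsScalarTower C (RatXY C) F]
    {D : Fin 2 → Derivation C F F}
    (hD : ∀ j f, D j (algebraMap (RatXY C) F f) = algebraMap (RatXY C) F (partialDeriv C j f))
    {s : F} (hs : s ^ 2 = algebraMap (RatXY C) F k) {h : RatXY C} {m : ℕ} {c : Fin m → C}
    {g : Fin m → RatXY C} (hne : quadField k h c g ≠ 0) : HasLogRelation D (quadField k h c g) := by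
  have hform := logForm_sqrt hD hk hs h c g
  refine ⟨m, c, fun i => (algebraMap _ F (g i) + s) / (algebraMap _ F (g i) - s),
    algebraMap _ F h * s,
    fun i => div_ne_zero (add_sqrt_ne_zero hk hs _) (sub_sqrt_ne_zero hk hs _), fun hzero => ?_, ?_⟩
  · have hs0 : s ≠ 0 := by
      rintro rfl
      exact sqrt_notMem_range hk hs ⟨0, map_zero _⟩
    have hγ : sqrtForm (partialDeriv C) k h c g = 0 := funext fun j => by
      simpa [hs0] using (hform j).symm.trans (congrFun hzero j)
    exact hne (by rw [quadField_eq_dualField hk, hγ, dualField_zero])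
  · simp_rw [hform, quadField_eq_dualField hk, ← mul_assoc, ← map_mul, ← Finset.sum_mul, ← map_sum,
      sum_dualField_mul, map_zero, zero_mul]

end RationalFirstIntegrals

section NoNewConstants

variable {C K L M : Type*} [Field C] [Field K] [Field L] [Field M] [Algebra C K] [Algebra C L]
  [Algebra C M] [Algebra K L] [Algebra L M] [Algebra K M] [IsScalarTower K L M]

/-- The derivations `D` on `L` commute, extend the derivations `d` on `K`, and have all their
constants in `K`. -/
structure IsNoNewConstantExtension (d : Fin 2 → Derivation C K K)
    (D : Fin 2 → Derivation C L L) : Prop where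
  map_algebraMap (j : Fin 2) (a : K) : D j (algebraMap K L a) = algebraMap K L (d j a)
  comm (f : L) : D 0 (D 1 f) = D 1 (D 0 f)
  exists_algebraMap_eq {f : L} (hf : IsConstant D f) : ∃ a, algebraMap K L a = f

theorem IsNoNewConstantExtension.refl {d : Fin 2 → Derivation C K K}
    (hd : ∀ f, d 0 (d 1 f) = d 1 (d 0 f)) : IsNoNewConstantExtension d d where
  map_algebraMap _ _ := rfl
  comm := hd
  exists_algebraMap_eq {f} _ := ⟨f, rfl⟩

theorem IsNoNewConstantExtension.isConstant_of_algebraMap {d : Fin 2 → Derivation C K K}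
    {D : Fin 2 → Derivation C L L} (h : IsNoNewConstantExtension d D) {a : K}
    (ha : IsConstant D (algebraMap K L a)) : IsConstant d a := fun j => by
  rw [← map_eq_zero (algebraMap K L), ← h.map_algebraMap, ha]

theorem IsNoNewConstantExtension.trans {d : Fin 2 → Derivation C K K}
    {D : Fin 2 → Derivation C L L} {E : Fin 2 → Derivation C M M}
    (hdD : IsNoNewConstantExtension d D) (hDE : IsNoNewConstantExtension D E) :
    IsNoNewConstantExtension d E where
  map_algebraMap j a := by
    rw [IsScalarTower.algebraMap_apply K L M, IsScalarTower.algebraMap_apply K L M,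
      hDE.map_algebraMap, hdD.map_algebraMap]
  comm := hDE.comm
  exists_algebraMap_eq hf := by
    obtain ⟨b, rfl⟩ := hDE.exists_algebraMap_eq hf
    obtain ⟨a, rfl⟩ := hdD.exists_algebraMap_eq (hDE.isConstant_of_algebraMap hf)
    exact ⟨a, IsScalarTower.algebraMap_apply K L M a⟩

open IntermediateField in
theorem fieldRange_sup_adjoin_eq_top {T : Set M} (hT : adjoin L T = ⊤) :
    (IsScalarTower.toAlgHom K L M).fieldRange ⊔ adjoin K T = ⊤ := by
  let S : IntermediateField K M := (IsScalarTower.toAlgHom K L M).fieldRange ⊔ adjoin K T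
  let SL : IntermediateField L M := S.toSubfield.toIntermediateField fun a =>
    (le_sup_left : _ ≤ S) ⟨a, rfl⟩
  have hle : adjoin L T ≤ SL :=
    adjoin_le_iff.2 ((subset_adjoin K T).trans (le_sup_right : _ ≤ S))
  exact eq_top_iff.2 fun x _ => hle (hT ▸ mem_top)

open IntermediateField in
theorem adjoin_image_union_eq_top {S : Set L} {T : Set M} (hS : adjoin K S = ⊤)
    (hT : adjoin L T = ⊤) : adjoin K (algebraMap L M '' S ∪ T) = ⊤ := by
  rw [adjoin_union, ← fieldRange_sup_adjoin_eq_top (K := K) hT, AlgHom.fieldRange_eq_map, ← hS,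
    adjoin_map, IsScalarTower.coe_toAlgHom']

end NoNewConstants

section PolynomialDerivations

open Polynomial

variable {C R : Type*} [CommRing C] [CommRing R] [Algebra C R]

/-- The derivation of `R[X]` that extends `d` and sends `X` to `e`. -/
def polyDerivation (d : Derivation C R R) (e : R) : Derivation C R[X] R[X] :=
  PolynomialModule.equivPolynomialSelf.toLinearMap.compDer d.mapCoeffs +
    Polynomial.C e • (Polynomial.derivative' (R := R)).restrictScalars C

theorem coeff_polyDerivation (d : Derivation C R R) (e : R) (p : R[X]) (n : ℕ) :
    (polyDerivation d e p).coeff n = d (p.coeff n) + e * (p.coeff (n + 1) * (n + 1)) := by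
  have hmap : (PolynomialModule.equivPolynomial (d.mapCoeffs p)).coeff n = d (p.coeff n) := rfl
  simp [polyDerivation, hmap, coeff_derivative]

theorem polyDerivation_C (d : Derivation C R R) (e a : R) :
    polyDerivation d e (Polynomial.C a) = Polynomial.C (d a) := by
  ext n
  rcases n with _ | n <;> simp [coeff_polyDerivation, coeff_C]

theorem polyDerivation_X (d : Derivation C R R) (e : R) :
    polyDerivation d e X = Polynomial.C e := by
  ext n
  rcases n with _ | n <;> simp [coeff_polyDerivation, coeff_C, coeff_X, apply_ite d]

theorem polyDerivation_comm {d : Fin 2 → Derivation C R R} {e : Fin 2 → R}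
    (hd : ∀ a, d 0 (d 1 a) = d 1 (d 0 a)) (he : d 0 (e 1) = d 1 (e 0)) (p : R[X]) :
    polyDerivation (d 0) (e 0) (polyDerivation (d 1) (e 1) p) =
      polyDerivation (d 1) (e 1) (polyDerivation (d 0) (e 0) p) := by
  ext n
  simp only [coeff_polyDerivation, map_add, Derivation.leibniz, smul_eq_mul, hd, he,
    Derivation.map_natCast, Derivation.map_one_eq_zero]
  ring

theorem polyDerivation_eq_zero_of_dvd {d : Derivation C R R} {e : R} {p : R[X]} (hp : p.Monic)
    (h : p ∣ polyDerivation d e p) : polyDerivation d e p = 0 := by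
  nontriviality R
  by_contra hne
  refine hp.not_dvd_of_degree_lt hne ?_ h
  rw [degree_eq_natDegree hp.ne_zero, degree_lt_iff_coeff_zero]
  intro n hn
  have hcoeff : d (p.coeff n) = 0 := by
    rcases hn.eq_or_lt with rfl | hn
    · rw [hp.coeff_natDegree, d.map_one_eq_zero]
    · rw [coeff_eq_zero_of_natDegree_lt hn, map_zero]
  rw [coeff_polyDerivation, hcoeff, coeff_eq_zero_of_natDegree_lt (Nat.lt_succ_of_le hn), zero_mul,
    mul_zero, add_zero]

variable {ι F : Type*} [Field F] [CharZero F] [Algebra C F] {d : ι → Derivation C F F} {e : ι → F}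

/- If `p = a Xⁿ⁺¹ + b Xⁿ + ⋯` is killed, comparing the two leading coefficients shows that
`-b / ((n + 1) a)` is a primitive of `e`. -/
theorem natDegree_eq_zero_of_polyDerivation_eq_zero (he : ¬ ∃ w, ∀ j, d j w = e j) {p : F[X]}
    (h : ∀ j, polyDerivation (d j) (e j) p = 0) : p.natDegree = 0 := by
  by_contra hdeg
  obtain ⟨n, hn⟩ := Nat.exists_eq_succ_of_ne_zero hdeg
  have hcoeff : ∀ j i, d j (p.coeff i) + e j * (p.coeff (i + 1) * (i + 1)) = 0 := fun j i => by
    rw [← coeff_polyDerivation, h, coeff_zero]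
  have hlead : p.coeff (n + 1) ≠ 0 := by
    rw [← Nat.succ_eq_add_one, ← hn, coeff_natDegree, leadingCoeff_ne_zero]
    exact ne_zero_of_natDegree_gt (Nat.pos_of_ne_zero hdeg)
  have hlead_const : ∀ j, d j (p.coeff (n + 1)) = 0 := fun j => by
    simpa [coeff_eq_zero_of_natDegree_lt (show p.natDegree < n + 1 + 1 by omega)] using
      hcoeff j (n + 1)
  have hn1 : (n + 1 : F) ≠ 0 := Nat.cast_add_one_ne_zero n
  refine he ⟨-(p.coeff n / (p.coeff (n + 1) * (n + 1))), fun j => ?_⟩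
  rw [map_neg, Derivation.leibniz_div_const _ _ _ (by simp [hlead_const]), smul_eq_mul]
  field_simp
  linear_combination -hcoeff j n

theorem isUnit_of_dvd_polyDerivation (he : ¬ ∃ w, ∀ j, d j w = e j) {p : F[X]} (hp : p ≠ 0)
    (h : ∀ j, p ∣ polyDerivation (d j) (e j) p) : IsUnit p := by
  have hunit : IsUnit (Polynomial.C p.leadingCoeff⁻¹) :=
    isUnit_C.2 (inv_ne_zero (leadingCoeff_ne_zero.2 hp)).isUnit
  have hmonic := monic_mul_leadingCoeff_inv hp
  have hzero : ∀ j, polyDerivation (d j) (e j) (p * Polynomial.C p.leadingCoeff⁻¹) = 0 :=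
    fun j => polyDerivation_eq_zero_of_dvd hmonic <| by
      rw [hunit.mul_right_dvd, Derivation.leibniz]
      exact dvd_add (Dvd.intro _ rfl) ((h j).mul_left _)
  have hone := hmonic.natDegree_eq_zero.1 (natDegree_eq_zero_of_polyDerivation_eq_zero he hzero)
  exact IsUnit.of_mul_eq_one _ hone

end PolynomialDerivations

section AdjoiningPrimitives

open IntermediateField

variable {C : Type*} {F : Type u} [Field C] [Field F] [CharZero F] [Algebra C F]
  {d : Fin 2 → Derivation C F F}

theorem exists_transcendental_primitive_extension (hd : ∀ f, d 0 (d 1 f) = d 1 (d 0 f))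
    {e : Fin 2 → F} (he : d 0 (e 1) = d 1 (e 0)) (hprim : ¬ ∃ w, ∀ j, d j w = e j) :
    ∃ D : Fin 2 → Derivation C (RatFunc F) (RatFunc F),
      IsNoNewConstantExtension d D ∧ ∀ j, D j RatFunc.X = algebraMap F (RatFunc F) (e j) := by
  have : Algebra.FormallyEtale (Polynomial F) (RatFunc F) :=
    Algebra.FormallyEtale.of_isLocalization (nonZeroDivisors (Polynomial F))
  obtain ⟨D, hD, hDcomm⟩ := exists_commuting_extension (C := C) (B := RatFunc F)
    (fun j => polyDerivation (d j) (e j)) (polyDerivation_comm hd he)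
  have hC : ∀ a, algebraMap F (RatFunc F) a = algebraMap (Polynomial F) _ (Polynomial.C a) :=
    fun a => IsScalarTower.algebraMap_apply F (Polynomial F) _ a
  refine ⟨D, ⟨fun j a => ?_, hDcomm, fun {f} hf => ?_⟩, fun j => ?_⟩
  · rw [hC, hC, hD, polyDerivation_C]
  · obtain ⟨p, hp, rfl⟩ := exists_algebraMap_eq_of_forall_derivation_eq_zero hD
      (fun _ => isUnit_of_dvd_polyDerivation hprim) hf
    refine ⟨p.coeff 0, ?_⟩
    rw [hC, ← Polynomial.eq_C_of_natDegree_eq_zero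
      (natDegree_eq_zero_of_polyDerivation_eq_zero hprim hp)]
  · rw [hC, ← RatFunc.algebraMap_X, hD, polyDerivation_X]

theorem exists_primitive_extension (hd : ∀ f, d 0 (d 1 f) = d 1 (d 0 f)) {e : Fin 2 → F}
    (he : d 0 (e 1) = d 1 (e 0)) :
    ∃ (L : Type u) (_ : Field L) (_ : Algebra C L) (_ : Algebra F L) (_ : IsScalarTower C F L)
      (D : Fin 2 → Derivation C L L) (t : L), IsNoNewConstantExtension d D ∧
        (∀ j, D j t = algebraMap F L (e j)) ∧ F⟮t⟯ = ⊤ := by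
  by_cases hprim : ∃ w, ∀ j, d j w = e j
  · obtain ⟨w, hw⟩ := hprim
    exact ⟨F, _, _, Algebra.id F, inferInstance, d, w, .refl hd, hw,
      Subsingleton.elim _ _⟩
  · obtain ⟨D, hD, hX⟩ := exists_transcendental_primitive_extension hd he hprim
    exact ⟨RatFunc F, _, _, _, inferInstance, D, RatFunc.X, hD, hX, RatFunc.adjoin_X⟩

theorem exists_primitives_extension (hd : ∀ f, d 0 (d 1 f) = d 1 (d 0 f)) {n : ℕ}
    {e : Fin n → Fin 2 → F} (he : ∀ i, d 0 (e i 1) = d 1 (e i 0)) :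
    ∃ (L : Type u) (_ : Field L) (_ : Algebra C L) (_ : Algebra F L) (_ : IsScalarTower C F L)
      (D : Fin 2 → Derivation C L L) (t : Fin n → L), IsNoNewConstantExtension d D ∧
        (∀ i j, D j (t i) = algebraMap F L (e i j)) ∧ adjoin F (Set.range t) = ⊤ := by
  induction n with
  | zero =>
    exact ⟨F, _, _, Algebra.id F, inferInstance, d, Fin.elim0, .refl hd, fun i => i.elim0,
      Subsingleton.elim _ _⟩
  | succ n ih =>
    obtain ⟨L, _, _, _, _, D, t, hD, ht, hgen⟩ := ih fun i => he i.castSucc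
    have : CharZero L := charZero_of_injective_algebraMap (algebraMap F L).injective
    obtain ⟨M, _, _, _, _, E, s, hE, hs, hgen'⟩ := exists_primitive_extension hD.comm
      (e := fun j => algebraMap F L (e (Fin.last n) j))
      (by rw [hD.map_algebraMap, hD.map_algebraMap, he])
    let _ : Algebra F M := Algebra.compHom M (algebraMap F L)
    have : IsScalarTower F L M := IsScalarTower.of_algebraMap_eq fun _ => rfl
    have : IsScalarTower C F M := .of_algebraMap_eq fun a => by
      rw [IsScalarTower.algebraMap_apply F L M, ← IsScalarTower.algebraMap_apply C F L,
        ← IsScalarTower.algebraMap_apply C L M]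
    refine ⟨M, _, _, _, inferInstance, E, Fin.snoc (fun i => algebraMap L M (t i)) s,
      hD.trans hE, fun i j => ?_, ?_⟩
    · induction i using Fin.lastCases with
      | last => rw [Fin.snoc_last, hs, IsScalarTower.algebraMap_apply F L M]
      | cast i => rw [Fin.snoc_castSucc, hE.map_algebraMap, ht,
          IsScalarTower.algebraMap_apply F L M]
    · rw [Fin.range_snoc, Set.range_comp', ← Set.union_singleton]
      exact adjoin_image_union_eq_top hgen hgen'

end AdjoiningPrimitives

section ElementaryTowers

open IntermediateField

variable {C L : Type*} [Field C] [Field L] [Algebra C L] [Algebra (RatXY C) L]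
  {D : Fin 2 → Derivation C L L}

theorem IsElementaryTower.of_finiteDimensional (E : IntermediateField (RatXY C) L)
    [FiniteDimensional (RatXY C) E] : IsElementaryTower D E :=
  have : FiniteDimensional (RatXY C) (extendScalars (bot_le : ⊥ ≤ E)) := ‹_›
  .algebraic ⊥ E .base bot_le (Module.Finite.of_restrictScalars_finite (RatXY C) _ _)

theorem IsElementaryTower.sup_adjoin_logarithms {T : IntermediateField (RatXY C) L}
    (hT : IsElementaryTower D T) {ι : Type*} [Finite ι] {t R : ι → L} (hR : ∀ i, R i ∈ T)
    (hR0 : ∀ i, R i ≠ 0) (ht : ∀ i j, D j (t i) = D j (R i) / R i) :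
    IsElementaryTower D (T ⊔ adjoin (RatXY C) (Set.range t)) := by
  classical
  have := Fintype.ofFinite ι
  suffices ∀ A : Finset ι, IsElementaryTower D (T ⊔ adjoin (RatXY C) (t '' A)) by
    simpa using this Finset.univ
  intro A
  induction A using Finset.induction_on with
  | empty => simpa using hT
  | insert i A _ ih =>
    rw [Finset.coe_insert, Set.image_insert_eq, ← Set.union_singleton, adjoin_union, ← sup_assoc]
    exact .logarithm _ (t i) (R i) ih ((le_sup_left : T ≤ _) (hR i)) (hR0 i) (ht i)

variable {F : Type*} [Field F] [Algebra (RatXY C) F] [FiniteDimensional (RatXY C) F] [Algebra F L]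
  [IsScalarTower (RatXY C) F L]

theorem IsNoNewConstantExtension.isElementaryExtension
    (hD : IsNoNewConstantExtension (partialDeriv C) D) {ι : Type*} [Finite ι] {t : ι → L}
    {u : ι → F} (hu : ∀ i, u i ≠ 0)
    (ht : ∀ i j, D j (t i) = D j (algebraMap F L (u i)) / algebraMap F L (u i))
    (hgen : adjoin F (Set.range t) = ⊤) : IsElementaryExtension D := by
  refine ⟨⟨hD.map_algebraMap, hD.comm⟩, fun _ => hD.exists_algebraMap_eq, ?_⟩
  let E := (IsScalarTower.toAlgHom (RatXY C) F L).fieldRange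
  have : FiniteDimensional (RatXY C) E :=
    (AlgHom.equivFieldRange (IsScalarTower.toAlgHom (RatXY C) F L)).toLinearEquiv.finiteDimensional
  rw [← fieldRange_sup_adjoin_eq_top (K := RatXY C) hgen]
  exact (IsElementaryTower.of_finiteDimensional E).sup_adjoin_logarithms (fun i => ⟨u i, rfl⟩)
    (fun i => (map_ne_zero _).2 (hu i)) ht

end ElementaryTowers

section ElementaryFirstIntegrals

theorem HasLogRelation.hasElementaryFirstIntegral {C F : Type u} [Field C] [CharZero C] [Field F]
    [Algebra C F] [Algebra (RatXY C) F] [IsScalarTower C (RatXY C) F]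
    [FiniteDimensional (RatXY C) F] {d : Fin 2 → Derivation C F F}
    (hd : IsNoNewConstantExtension (partialDeriv C) d) {X : Fin 2 → RatXY C}
    (hX : HasLogRelation d X) : HasElementaryFirstIntegral X := by
  obtain ⟨m, c, u, v, hu, hβ, hXβ⟩ := hX
  have : CharZero F := charZero_of_injective_algebraMap (algebraMap C F).injective
  obtain ⟨L, _, _, _, _, D, t, hD, ht, hgen⟩ := exists_primitives_extension hd.comm
    (e := fun i j => d j (u i) / u i) fun i => logDeriv_closed hd.comm (u i)
  let _ : Algebra (RatXY C) L := Algebra.compHom L (algebraMap (RatXY C) F)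
  have : IsScalarTower (RatXY C) F L := IsScalarTower.of_algebraMap_eq fun _ => rfl
  have : IsScalarTower C (RatXY C) L := .of_algebraMap_eq fun a => by
    rw [IsScalarTower.algebraMap_apply (RatXY C) F L,
      ← IsScalarTower.algebraMap_apply C (RatXY C) F, ← IsScalarTower.algebraMap_apply C F L]
  let φ := ∑ i, c i • t i + algebraMap F L v
  have hφ : ∀ j, D j φ = algebraMap F L (logForm d c u v j) := fun j => by
    simp only [φ, logForm, map_add, map_sum, Derivation.map_smul, ht, hD.map_algebraMap,
      algebraMap.coe_smul]
  refine ⟨L, _, _, _, inferInstance, D, (hd.trans hD).isElementaryExtension hu (fun i j => ?_) hgen,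
    φ, fun hconst => hβ (funext fun j => ?_), ?_⟩
  · rw [ht, hD.map_algebraMap, map_div₀]
  · rw [Pi.zero_apply, ← map_eq_zero (algebraMap F L), ← hφ, hconst]
  · simp only [lieDeriv, hφ, IsScalarTower.algebraMap_apply (RatXY C) F L, ← map_mul, ← map_sum,
      hXβ, map_zero]

end ElementaryFirstIntegrals

section ExceptionalFields

theorem isExceptional_quadField_iff {C : Type u} [Field C] [CharZero C] {k : RatXY C}
    (hk : ∀ a : C, a ≠ 0 → ¬ IsSquare (a • k)) (h : RatXY C) {m : ℕ} (c : Fin m → C)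
    (g : Fin m → RatXY C) :
    IsExceptional (quadField k h c g) ↔ ¬ HasRationalFirstIntegral (quadField k h c g) := by
  refine ⟨fun hexc hrat => hexc.2 hrat.hasLogRelation, fun hrat =>
    ⟨?_, not_hasLogRelation_quadField hk hrat⟩⟩
  have hksq : ¬ IsSquare k := by simpa using hk 1 one_ne_zero
  have hne : quadField k h c g ≠ 0 := fun hzero => hrat (hzero ▸ hasRationalFirstIntegral_zero)
  have hk' : ∀ e, IsConstant (partialDeriv C) e → e ≠ 0 → ¬ IsSquare (e * k) := by
    intro e he he0
    obtain ⟨a, rfl⟩ := exists_algebraMap_eq_of_isConstant he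
    rw [← Algebra.smul_def]
    exact hk a (by simpa using he0)
  obtain ⟨F, _, _, _, _, _, D, s, hD, hDcomm, hs⟩ := exists_sqrt_extension partialDeriv_comm hksq
  have hconst : IsNoNewConstantExtension (partialDeriv C) D :=
    ⟨hD, hDcomm, exists_algebraMap_eq_of_isConstant_sqrt hD hs hk'⟩
  exact (hasLogRelation_quadField hksq hD hs hne).hasElementaryFirstIntegral hconst

theorem not_isSquare_smul {C R : Type*} [Field C] [IsAlgClosed C] [CommSemiring R] [Algebra C R]
    {k : R} (hk : ¬ IsSquare k) {a : C} (ha : a ≠ 0) : ¬ IsSquare (a • k) := by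
  obtain ⟨b, rfl⟩ := IsAlgClosed.exists_pow_nat_eq a two_pos
  have hb : b ≠ 0 := by
    rintro rfl
    exact ha (zero_pow two_ne_zero)
  rintro ⟨w, hw⟩
  refine hk ⟨b⁻¹ • w, ?_⟩
  rw [smul_mul_smul_comm, ← hw, smul_smul, pow_two, mul_mul_mul_comm, inv_mul_cancel₀ hb, mul_one,
    one_smul]

end ExceptionalFields

end PlaneVF

end

theorem mainTheorem4_general {C : Type*} [Field C] [CharZero C] :
    (∀ (L : Type*) [Field L] [Algebra C L] [Algebra (PlaneVF.RatXY C) L]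
        [IsScalarTower C (PlaneVF.RatXY C) L] (D : Fin 2 → Derivation C L L),
      (∀ j f, D j (algebraMap (PlaneVF.RatXY C) L f) =
        algebraMap (PlaneVF.RatXY C) L (PlaneVF.partialDeriv C j f)) →
      Module.finrank (PlaneVF.RatXY C) L = 2 →
      ∀ X : Fin 2 → PlaneVF.RatXY C,
        ¬ PlaneVF.HasLogRelation (PlaneVF.partialDeriv C) X → PlaneVF.HasLogRelation D X →
        (∃ k : PlaneVF.RatXY C, PlaneVF.IsQuadraticGenerator L k) ∧
        ∀ k : PlaneVF.RatXY C, PlaneVF.IsQuadraticGenerator L k →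
          ∃ (r h : PlaneVF.RatXY C) (m : ℕ) (c : Fin m → C) (g : Fin m → PlaneVF.RatXY C),
            LinearIndependent ℚ c ∧ X = r • PlaneVF.quadField k h c g) ∧
    (∀ (k h : PlaneVF.RatXY C) (m : ℕ) (c : Fin m → C) (g : Fin m → PlaneVF.RatXY C),
      (∀ a : C, a ≠ 0 → ¬ IsSquare (a • k)) →
        (PlaneVF.IsExceptional (PlaneVF.quadField k h c g) ↔
          ¬ PlaneVF.HasRationalFirstIntegral (PlaneVF.quadField k h c g))) := by
  refine ⟨fun L _ _ _ _ D hD h2 X hX hXL => ?_, fun k h m c g hk =>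
    PlaneVF.isExceptional_quadField_iff hk h c g⟩
  have : Algebra.IsQuadraticExtension (PlaneVF.RatXY C) L := ⟨h2⟩
  refine ⟨PlaneVF.exists_sqrt_generator (PlaneVF.RatXY C) L, ?_⟩
  rintro k ⟨hk, s, hs⟩
  exact PlaneVF.exists_eq_smul_quadField hD hX hXL hk hs

theorem mainTheorem4 {C : Type*} [Field C] [IsAlgClosed C] [CharZero C] :
    (∀ (L : Type*) [Field L] [Algebra C L] [Algebra (PlaneVF.RatXY C) L]
        [IsScalarTower C (PlaneVF.RatXY C) L] (D : Fin 2 → Derivation C L L),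
      PlaneVF.IsDifferentialExtension D → Module.finrank (PlaneVF.RatXY C) L = 2 →
      ∀ X : Fin 2 → PlaneVF.RatXY C,
        PlaneVF.IsExceptional X → PlaneVF.HasLogRelation D X →
        (∃ k : PlaneVF.RatXY C, PlaneVF.IsQuadraticGenerator L k) ∧
        ∀ k : PlaneVF.RatXY C, PlaneVF.IsQuadraticGenerator L k →
          ∃ (r h : PlaneVF.RatXY C) (m : ℕ) (c : Fin m → C) (g : Fin m → PlaneVF.RatXY C),
            LinearIndependent ℚ c ∧ X = r • PlaneVF.quadField k h c g) ∧
    (∀ (k h : PlaneVF.RatXY C) (m : ℕ) (c : Fin m → C) (g : Fin m → PlaneVF.RatXY C),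
      ¬ IsSquare k →
        (PlaneVF.IsExceptional (PlaneVF.quadField k h c g) ↔
          ¬ PlaneVF.HasRationalFirstIntegral (PlaneVF.quadField k h c g))) := by
  obtain ⟨hquad, hexc⟩ := mainTheorem4_general (C := C)
  exact ⟨fun L _ _ _ _ D hD h2 X hX => hquad L D hD.1 h2 X hX.2, fun k h m c g hk =>
    hexc k h m c g fun _ => PlaneVF.not_isSquare_smul hk⟩
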